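/- Let \(G\) be a group, \(R\) a commutative ring with \(1\), and \(V\) a representation of \(G\) over \(R\) that is free and finitely generated as an \(R\)-module; fix a finite totally ordered \(R\)-basis \(\mathcal B\) of \(V\). Let \(\lambda\) be a partition of \(n\ge 0\), with conjugate \(\lambda'\) and Young diagram \(Y=\{(i,j): 1\le i\le\lambda'_1,\ 1\le j\le\lambda_i\}\). A tableau is a map \(t\colon Y\to\mathcal B\); it is semistandard if its entries weakly increase along rows and strictly increase down columns. We identify \(t\) with the pure tensor \(\bigotimes_{c\in Y}t(c)\in V^{\otimes Y}\cong V^{\otimes n}\). The group \(S_Y\) of permutations of \(Y\) acts on tableaux and on \(V^{\otimes Y}\) by place permutation, \(t\cdot\sigma\) being the tableau whose entry in the box \(\sigma(c)\) is \(t(c)\). Let \(\mathrm{RPP}\le S_Y\) be the subgroup of permutations preserving every row, call \(t,u\) row equivalent if \(u=t\cdot\sigma\) for some \(\sigma\in\mathrm{RPP}\), and let \(\mathrm{RStab}(t)=\{\sigma\in\mathrm{RPP}: t\cdot\sigma=t\}\). - \(\mathrm{Sym}_\lambda(V)\subseteq V^{\otimes Y}\) is the submodule of tensors invariant under \(\mathrm{RPP}\),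 i.e. \(\bigotimes_i \mathrm{Sym}_{\lambda_i}(V)\) where \(\mathrm{Sym}_r(V)\subseteq V^{\otimes r}\) is the module of symmetric tensors. The row symmetrisation of a tableau \(t\) is \(\mathrm{rsym}(t)=\sum_{\tau\in \mathrm{RStab}(t)\backslash\mathrm{RPP}}t\cdot\tau\in\mathrm{Sym}_\lambda(V)\). - \(\bigwedge^{\lambda'}(V)=\bigotimes_{j}\bigwedge^{\lambda'_j}(V)\), and \(V^{\otimes Y}\to\bigwedge^{\lambda'}(V)\) is the projection taking the wedge product of the factors in each column. Write \(|t|\) for the image of a tableau \(t\). The copolytabloid of \(t\) is \(\sum_{\tau\in \mathrm{RStab}(t)\backslash\mathrm{RPP}}|t\cdot\tau|\), and \(\mathsf{copolytab}^\lambda(V)\subseteq\bigwedge^{\lambda'}(V)\) is the \(R\)-span of all copolytabloids. - Let \(t\) be a tableau, let \(1\le i<i'\le\lambda'_1\), and let \(A\), \(B\) be sets of boxes in rows \(i\) and \(i'\) respectively with \(|A|+|B|>\lambda_i\). Let \(\mathcal T\) be the set (not multiset) of tableaux \(t\cdot\tau\) with \(\tau\in S_{A\sqcup B}\). The dual Garnir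 relation labelled by \((t,A,B)\) is \[\sum_{u}\bigl|\mathrm{RStab}(u):\mathrm{RStab}(u)\cap(S_{A\sqcup B}\times S_{Y\setminus(A\sqcup B)})\bigr|\;\mathrm{rsym}(u)\in\mathrm{Sym}_\lambda(V),\] where \(u\) runs over a set of representatives, chosen from \(\mathcal T\), of \(\mathcal T\) modulo row equivalence. Let \(\mathsf{GR}_\lambda(V)\subseteq\mathrm{Sym}_\lambda(V)\) be the \(R\)-span of all dual Garnir relations. Then: (a) \(\mathsf{GR}_\lambda(V)\) and \(\mathsf{copolytab}^\lambda(V)\) are stable under \(G\), and there is a short exact sequence of representations of \(G\) over \(R\) \[0\to\mathsf{GR}_\lambda(V)\to\mathrm{Sym}_\lambda(V)\xrightarrow{\ \Lambda\ }\mathsf{copolytab}^\lambda(V)\to0,\] whose first map is the inclusion and where \(\Lambda\) is the restriction of the projection \(V^{\otimes Y}\to\bigwedge^{\lambda'}(V)\); it sends \(\mathrm{rsym}(t)\) to the copolytabloid of \(t\) for every tableau \(t\). (b) The copolytabloids of the semistandard tableaux form an \(R\)-basis of \(\mathsf{copolytab}^\lambda(V)\), indexed by the semistandard tableaux. -/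

import Mathlib

open scoped TensorProduct

noncomputable section

namespace Weyl

/-! ### Young diagrams, place permutations and tableaux

A partition is represented by its Young diagram `μ`; rows and columns are numbered from `0`, so
`μ.rowLen i` is the part number `i + 1` of the partition and `μ.colLen j` is the part number
`j + 1` of the conjugate partition. -/

/-- The boxes of the Young diagram `μ`. -/
abbrev Box (μ : YoungDiagram) : Type := {c : ℕ × ℕ // c ∈ μ.cells}

/-- The row of a box. -/
def Box.row {μ : YoungDiagram} (c : Box μ) : ℕ := c.1.1

/-- The column of a box. -/
def Box.col {μ : YoungDiagram} (c : Box μ) : ℕ := c.1.2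

/-- Tableaux of shape `μ` with entries in `κ`: arbitrary fillings of the boxes. -/
abbrev Tableau (μ : YoungDiagram) (κ : Type*) : Type _ := Box μ → κ

/-- Semistandard: weakly increasing along the rows, strictly increasing down the columns. -/
def IsSemistandard {μ : YoungDiagram} {κ : Type*} [LinearOrder κ] (t : Tableau μ κ) : Prop :=
  (∀ c d : Box μ, c.row = d.row → c.col < d.col → t c ≤ t d) ∧
  (∀ c d : Box μ, c.col = d.col → c.row < d.row → t c < t d)

/-- The row-preserving place permutations `RPP(μ)`. -/
def rowPerms (μ : YoungDiagram) : Subgroup (Equiv.Perm (Box μ)) where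
  carrier := {σ | ∀ c, (σ c).row = c.row}
  one_mem' := fun _ => rfl
  mul_mem' := by
    intro σ τ hσ hτ c
    exact (hσ (τ c)).trans (hτ c)
  inv_mem' := by
    intro σ hσ c
    have h := hσ (σ.symm c)
    rw [Equiv.apply_symm_apply] at h
    exact h.symm

/-- The place permutation action on tableaux: the entry in the box `c` moves to the box `σ c`. -/
def place {μ : YoungDiagram} {κ : Type*} (t : Tableau μ κ) (σ : Equiv.Perm (Box μ)) :
    Tableau μ κ :=
  fun c => t (σ.symm c)

/-- Row equivalence of tableaux. -/
def RowEquiv {μ : YoungDiagram} {κ : Type*} (t u : Tableau μ κ) : Prop :=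
  ∃ σ ∈ rowPerms μ, place t σ = u

open Classical in
/-- The set (not multiset) of the tableaux `t · τ` with `τ ∈ RPP(μ)`. The map `τ ↦ t · τ`
identifies the right cosets of the row stabiliser of `t` in `RPP(μ)` with this set, so that a sum
over it is a sum over coset representatives. -/
def rowOrbit {μ : YoungDiagram} {κ : Type*} (t : Tableau μ κ) : Finset (Tableau μ κ) :=
  (Finset.univ.filter (fun σ : Equiv.Perm (Box μ) => σ ∈ rowPerms μ)).image (place t)

/-- The row stabiliser of a tableau. -/
def rowStab {μ : YoungDiagram} {κ : Type*} (t : Tableau μ κ) :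
    Subgroup (Equiv.Perm (Box μ)) where
  carrier := {σ | σ ∈ rowPerms μ ∧ place t σ = t}
  one_mem' := ⟨(rowPerms μ).one_mem, rfl⟩
  mul_mem' := by
    rintro σ τ ⟨hσ, hσt⟩ ⟨hτ, hτt⟩
    refine ⟨(rowPerms μ).mul_mem hσ hτ, ?_⟩
    funext c
    exact (congrFun hτt (σ.symm c)).trans (congrFun hσt c)
  inv_mem' := by
    rintro σ ⟨hσ, hσt⟩
    refine ⟨(rowPerms μ).inv_mem hσ, ?_⟩
    funext c
    have h := congrFun hσt (σ c)
    simp only [place, Equiv.symm_apply_apply] at h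
    exact h.symm

/-- The permutations of the boxes that map `C` to itself, that is, `S_C × S_{Cᶜ}`. -/
def splitPerms {μ : YoungDiagram} (C : Finset (Box μ)) : Subgroup (Equiv.Perm (Box μ)) where
  carrier := {σ | ∀ c, σ c ∈ C ↔ c ∈ C}
  one_mem' := fun _ => Iff.rfl
  mul_mem' := by
    intro σ τ hσ hτ c
    exact (hσ (τ c)).trans (hτ c)
  inv_mem' := by
    intro σ hσ c
    have h := hσ (σ.symm c)
    rw [Equiv.apply_symm_apply] at h
    exact h.symm

/-- The set of the tableaux `t · τ` with `τ ∈ S_C` (permutations that fix every box outside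
`C`). -/
def permutedIn {μ : YoungDiagram} {κ : Type*} (t : Tableau μ κ) (C : Finset (Box μ)) :
    Set (Tableau μ κ) :=
  {u | ∃ τ : Equiv.Perm (Box μ), (∀ c, c ∉ C → τ c = c) ∧ u = place t τ}

/-- `S` is a set of representatives, chosen from `T`, for `T` modulo row equivalence. -/
def IsRowTransversal {μ : YoungDiagram} {κ : Type*} (T : Set (Tableau μ κ))
    (S : Finset (Tableau μ κ)) : Prop :=
  (∀ u ∈ S, u ∈ T) ∧ ∀ u ∈ T, ∃! s, s ∈ S ∧ RowEquiv s u

/-! ### Row-symmetric tensors and the exterior power -/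

section Modules

variable (R : Type*) [CommRing R] (V : Type*) [AddCommGroup V] [Module R V] (μ : YoungDiagram)

/-- The tensor power of `V` with one factor for each box of `μ`. -/
abbrev TensorPow : Type _ := ⨂[R] _c : Box μ, V

/-- The module `Sym_μ V`: the tensors that are symmetric under permuting places within each row
(the tensor product of the modules of symmetric tensors in the row factors). -/
def lowerSym : Submodule R (TensorPow R V μ) where
  carrier := {x | ∀ σ ∈ rowPerms μ, PiTensorProduct.reindex R (fun _ : Box μ => V) σ x = x}
  add_mem' := by
    intro x y hx hy σ hσ
    rw [map_add, hx σ hσ, hy σ hσ]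
  zero_mem' := fun σ _ => map_zero _
  smul_mem' := by
    intro r x hx σ hσ
    rw [map_smul, hx σ hσ]

/-- The exterior power attached to the conjugate partition: the tensor product, over the columns,
of the exterior powers of `V` of degree the length of the column. -/
abbrev ColWedge : Type _ := ⨂[R] j : Fin (μ.rowLen 0), ⋀[R]^(μ.colLen j) V

/-- The boxes of `μ`, listed column by column. -/
def colBoxEquiv : (Σ j : Fin (μ.rowLen 0), Fin (μ.colLen j)) ≃ Box μ where
  toFun p := ⟨((p.2 : ℕ), (p.1 : ℕ)), YoungDiagram.mem_iff_lt_colLen.mpr p.2.2⟩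
  invFun c :=
    ⟨⟨c.1.2, lt_of_lt_of_le (YoungDiagram.mem_iff_lt_rowLen.mp c.2)
        (μ.rowLen_anti 0 c.1.1 (Nat.zero_le _))⟩,
      ⟨c.1.1, YoungDiagram.mem_iff_lt_colLen.mp c.2⟩⟩
  left_inv _ := rfl
  right_inv _ := rfl

/-- The projection from the tensor power to the exterior power, see `colProj_tprod`. -/
def colProj : TensorPow R V μ →ₗ[R] ColWedge R V μ :=
  PiTensorProduct.lift
    (((PiTensorProduct.tprod R).compMultilinearMap
      (fun j : Fin (μ.rowLen 0) =>
        (exteriorPower.ιMulti R (μ.colLen j) (M := V)).toMultilinearMap)).domDomCongr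
      (colBoxEquiv μ))

theorem colProj_tprod (x : Box μ → V) :
    colProj R V μ (PiTensorProduct.tprod R x) =
      PiTensorProduct.tprod R (fun j : Fin (μ.rowLen 0) =>
        exteriorPower.ιMulti R (μ.colLen j)
          (fun i : Fin (μ.colLen j) => x (colBoxEquiv μ ⟨j, i⟩))) := by
  rw [colProj, PiTensorProduct.lift.tprod]
  rfl

end Modules

/-! ### The action of a group -/

section Action

variable {R : Type*} [CommRing R] {V : Type*} [AddCommGroup V] [Module R V]
  {G : Type*} [Group G] (μ : YoungDiagram) (ρ : Representation R G V)

/-- The diagonal action on the tensor power. -/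
def tensorRep : Representation R G (TensorPow R V μ) :=
  PiTensorProduct.mapMonoidHom.comp (MonoidHom.pi fun _ : Box μ => ρ)

/-- The induced action on an exterior power. -/
def extRep (n : ℕ) : Representation R G (⋀[R]^n V) where
  toFun g := exteriorPower.map n (ρ g)
  map_one' := by
    rw [map_one]
    exact exteriorPower.map_id
  map_mul' g h := by
    rw [map_mul, Module.End.mul_eq_comp, Module.End.mul_eq_comp, exteriorPower.map_comp]

/-- The diagonal action on the tensor product of exterior powers. -/
def wedgeRep : Representation R G (ColWedge R V μ) :=
  PiTensorProduct.mapMonoidHom.comp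
    (MonoidHom.pi fun j : Fin (μ.rowLen 0) => extRep ρ (μ.colLen j))

/-- The row-symmetric tensors, as a subrepresentation of the tensor power. -/
def symSub : Subrepresentation (tensorRep μ ρ) where
  toSubmodule := lowerSym R V μ
  apply_mem_toSubmodule := by
    intro g x hx σ hσ
    have h := PiTensorProduct.map_reindex (R := R) (fun _ : Box μ => ρ g) σ x
    rw [hx σ hσ] at h
    exact h.symm

/-- The action on the row-symmetric tensors. -/
def symRep : Representation R G (lowerSym R V μ) := (symSub μ ρ).toRepresentation

end Action

/-! ### Row symmetrisations, copolytabloids and dual Garnir relations -/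

section Relations

variable {R : Type*} [CommRing R] {V : Type*} [AddCommGroup V] [Module R V] {κ : Type*}
  {μ : YoungDiagram} (b : Module.Basis κ R V)

/-- The tensor identified with a tableau; an index in `κ` stands for a basis vector. -/
def tabTensor (t : Tableau μ κ) : TensorPow R V μ :=
  PiTensorProduct.tprod R (fun c => b (t c))

theorem reindex_tabTensor (σ : Equiv.Perm (Box μ)) (t : Tableau μ κ) :
    PiTensorProduct.reindex R (fun _ : Box μ => V) σ (tabTensor b t) =
      tabTensor b (place t σ) :=
  PiTensorProduct.reindex_tprod σ _

theorem place_injective (σ : Equiv.Perm (Box μ)) :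
    Function.Injective (fun t : Tableau μ κ => place t σ) := by
  intro t u h
  funext c
  have h' := congrFun h (σ c)
  simpa only [place, Equiv.symm_apply_apply] using h'

theorem place_mem_rowOrbit {σ : Equiv.Perm (Box μ)} (hσ : σ ∈ rowPerms μ) {t u : Tableau μ κ}
    (hu : u ∈ rowOrbit t) : place u σ ∈ rowOrbit t := by
  classical
  simp only [rowOrbit, Finset.mem_image, Finset.mem_filter, Finset.mem_univ, true_and] at hu ⊢
  obtain ⟨τ, hτ, rfl⟩ := hu
  exact ⟨σ * τ, (rowPerms μ).mul_mem hσ hτ, rfl⟩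

/-- The row symmetrisation of a tableau. -/
def rsym (t : Tableau μ κ) : lowerSym R V μ :=
  ⟨∑ u ∈ rowOrbit t, tabTensor b u, by
    intro σ hσ
    rw [map_sum]
    simp only [reindex_tabTensor]
    refine Finset.sum_nbij (fun u => place u σ) (fun u hu => place_mem_rowOrbit hσ hu)
      (place_injective σ).injOn ?_ (fun _ _ => rfl)
    exact Finset.surjOn_of_injOn_of_card_le _ (fun u hu => place_mem_rowOrbit hσ hu)
      (place_injective σ).injOn le_rfl⟩

/-- The alternating column tabloid of a tableau: the tensor product over the columns of the
wedge products of the column entries, read from top to bottom. -/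
def colTabloid (t : Tableau μ κ) : ColWedge R V μ :=
  PiTensorProduct.tprod R (fun j : Fin (μ.rowLen 0) =>
    exteriorPower.ιMulti R (μ.colLen j)
      (fun i : Fin (μ.colLen j) => b (t (colBoxEquiv μ ⟨j, i⟩))))

/-- The copolytabloid of a tableau. -/
def copolytabloid (t : Tableau μ κ) : ColWedge R V μ :=
  ∑ u ∈ rowOrbit t, colTabloid b u

variable (μ) in
/-- The space of copolytabloids. -/
def copolytab : Submodule R (ColWedge R V μ) :=
  Submodule.span R (Set.range (copolytabloid (μ := μ) b))

/-- The sum, over a set `S` of tableaux, of the row symmetrisations `rsym u` with the index of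
`rowStab u ∩ (S_C × S_{Cᶜ})` in `rowStab u` as coefficient. -/
def garnirSum (C : Finset (Box μ)) (S : Finset (Tableau μ κ)) : lowerSym R V μ :=
  ∑ u ∈ S, (splitPerms C).relIndex (rowStab u) • rsym b u

/-- `x` is the dual Garnir relation labelled by `(t, A, B)`, for some choice of
representatives. -/
def IsDualGarnirRelation (t : Tableau μ κ) (A B : Finset (Box μ)) (x : lowerSym R V μ) : Prop :=
  (∃ i i' : ℕ, i < i' ∧ i' < μ.colLen 0 ∧ (∀ c ∈ A, c.row = i) ∧ (∀ c ∈ B, c.row = i') ∧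
    μ.rowLen i < A.card + B.card) ∧
  ∃ S : Finset (Tableau μ κ), IsRowTransversal (permutedIn t (A ∪ B)) S ∧
    x = garnirSum b (A ∪ B) S

variable (μ) in
/-- The space of dual Garnir relations. -/
def dualGarnir : Submodule R (lowerSym R V μ) :=
  Submodule.span R {x | ∃ t A B, IsDualGarnirRelation b t A B x}

end Relations

end Weyl

end

/-! Let `Λ` be the restriction of the projection to the row-symmetric tensors (`symProj`). Its
kernel and range are stable under the group because the projection is equivariant, so everything
follows from three facts about tableaux.

*The dual Garnir relations lie in the kernel of `Λ`* (`dualGarnir_le_ker_symProj`). By the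
orbit-stabiliser theorem the index attached to a tableau counts the images `E` of `D = A ∪ B` under
its row stabiliser. A dual Garnir relation is thus a sum over all images `E = σ D` of `D` under row
permutations `σ`; the terms for `E` are the tableaux `t · τ` with `τ` permuting `D`, transported by
`σ`, and they are permuted by the permutations of `E`. As `D`, hence `E`, has more boxes than the
longer of its two rows, two boxes of `E` lie in one column, and the transposition of their entries
pairs off terms of opposite sign (`sum_colTabloid_eq_zero`).

*Modulo the dual Garnir relations, the semistandard row symmetrisations span*
(`span_rsym_semistandard_sup_dualGarnir`). Let the rows of `t` increase weakly, let `c` be above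
`d` in a column and `t d ≤ t c`. Take for `A` the boxes of the row of `c` with entries `≥ t c` and
for `B` those of the row of `d` with entries `≤ t d`. These are unions of level sets of `t`, so that
`rsym t` occurs in the relation with coefficient one, and every other term has larger `weight`:
large entries are moved down (`rowEquiv_or_weight_lt`). Induction on the weight applies.

*The semistandard copolytabloids are linearly independent* (`linearIndependent_copolytabloid`).
Let `s`, `t` be semistandard. A tableau `u` of the row orbit of `t` contributes to the coefficient of
the column tabloid of `s` only if sorting its columns gives `s`; by the rearrangement inequality this
increases the weight strictly unless `u = s`, and then `t = s`. So the matrix of coefficients, read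
off by the functionals `colDual`, is unitriangular.

The last two facts show that the kernel of `Λ` is no larger than the span of the relations
(`ker_symProj`), and give the basis. -/

/-! ### Row equivalence -/

namespace Weyl

section Combinatorics

variable {μ : YoungDiagram} {κ : Type*}

theorem place_mul (t : Tableau μ κ) (σ τ : Equiv.Perm (Box μ)) :
    place t (σ * τ) = place (place t τ) σ := rfl

theorem place_eq_iff {t u : Tableau μ κ} {σ : Equiv.Perm (Box μ)} :
    place t σ = u ↔ ∀ c, u (σ c) = t c := by
  constructor
  · rintro rfl c
    simp [place]
  · intro h
    funext c
    simpa [place] using (h (σ.symm c)).symm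

@[simp] theorem place_apply_apply (t : Tableau μ κ) (σ : Equiv.Perm (Box μ)) (c : Box μ) :
    place t σ (σ c) = t c := by
  simp [place]

theorem mem_rowOrbit {t u : Tableau μ κ} : u ∈ rowOrbit t ↔ RowEquiv t u := by
  simp [rowOrbit, RowEquiv]

theorem RowEquiv.refl (t : Tableau μ κ) : RowEquiv t t := ⟨1, (rowPerms μ).one_mem, rfl⟩

theorem RowEquiv.symm {t u : Tableau μ κ} (h : RowEquiv t u) : RowEquiv u t := by
  obtain ⟨σ, hσ, rfl⟩ := h
  exact ⟨σ⁻¹, (rowPerms μ).inv_mem hσ, by rw [← place_mul, inv_mul_cancel]; rfl⟩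

theorem RowEquiv.trans {t u v : Tableau μ κ} (h : RowEquiv t u) (h' : RowEquiv u v) :
    RowEquiv t v := by
  obtain ⟨σ, hσ, rfl⟩ := h
  obtain ⟨τ, hτ, rfl⟩ := h'
  exact ⟨τ * σ, (rowPerms μ).mul_mem hτ hσ, rfl⟩

variable (μ κ) in
/-- Row equivalence as a setoid. -/
def rowSetoid : Setoid (Tableau μ κ) where
  r := RowEquiv
  iseqv := ⟨RowEquiv.refl, RowEquiv.symm, RowEquiv.trans⟩

theorem RowEquiv.rowOrbit_eq {t u : Tableau μ κ} (h : RowEquiv t u) : rowOrbit t = rowOrbit u := by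
  ext v
  rw [mem_rowOrbit, mem_rowOrbit]
  exact ⟨h.symm.trans, h.trans⟩

/-- A set of representatives for row equivalence can be chosen to contain a given tableau. -/
theorem exists_isRowTransversal [Finite κ] {T : Set (Tableau μ κ)} {t : Tableau μ κ}
    (ht : t ∈ T) : ∃ S : Finset (Tableau μ κ), IsRowTransversal T S ∧ t ∈ S := by
  classical
  let f : Tableau μ κ → Quotient (rowSetoid μ κ) := Quotient.mk _
  have h0 : Set.BijOn f {t} {f t} := by simp
  obtain ⟨S, htS, hST, hb⟩ := h0.exists_extend_of_subset (s₁ := T) (t' := f '' T)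
    (by simpa using ht) (by simpa using ⟨t, ht, rfl⟩) (Set.surjOn_image f T)
  have hfin : S.Finite := Set.toFinite S
  refine ⟨hfin.toFinset, ⟨fun u hu => hST (by simpa using hu), fun u hu => ?_⟩, by
    simpa using htS⟩
  obtain ⟨s, hs, hsu⟩ := hb.surjOn ⟨u, hu, rfl⟩
  refine ⟨s, ⟨by simpa using hs, Quotient.exact hsu⟩, ?_⟩
  rintro s' ⟨hs', hsu'⟩
  refine hb.injOn (by simpa using hs') hs ?_
  rw [hsu]
  exact Quotient.sound (s := rowSetoid μ κ) hsu'

/-- If two functions take every value equally often on `D`, a permutation of `D` carries one to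
the other. -/
theorem exists_perm_of_card_filter_eq {α β : Type*} [DecidableEq α] [DecidableEq β]
    (D : Finset α) (f g : α → β)
    (h : ∀ y, (D.filter fun a => f a = y).card = (D.filter fun a => g a = y).card) :
    ∃ σ : Equiv.Perm α, (∀ a, a ∉ D → σ a = a) ∧ ∀ a ∈ D, g (σ a) = f a := by
  have key : ∀ (k : α → β) (y : β),
      Nat.card {a : {a // a ∈ D} // k a = y} = (D.filter fun a => k a = y).card := by
    intro k y
    rw [Nat.card_congr (Equiv.subtypeSubtypeEquivSubtypeInter (fun a => a ∈ D)
      (fun a => k a = y)), Nat.subtype_card _ fun a => Finset.mem_filter]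
  have e : ∀ y, Nonempty ({a : {a // a ∈ D} // f a = y} ≃ {a : {a // a ∈ D} // g a = y}) := by
    intro y
    exact (Finite.card_eq).1 (by rw [key, key, h])
  let σ : Equiv.Perm {a // a ∈ D} :=
    Equiv.ofFiberEquiv (f := fun a : {a // a ∈ D} => f a) (g := fun a : {a // a ∈ D} => g a)
      fun y => (e y).some
  refine ⟨Equiv.Perm.ofSubtype σ, fun a ha => Equiv.Perm.ofSubtype_apply_of_not_mem σ ha,
    fun a ha => ?_⟩
  rw [Equiv.Perm.ofSubtype_apply_of_mem σ ha]
  exact Equiv.ofFiberEquiv_map (f := fun a : {a // a ∈ D} => f a)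
    (g := fun a : {a // a ∈ D} => g a) (fun y => (e y).some) ⟨a, ha⟩

/-- Row equivalent tableaux that agree outside `D` differ by a row-preserving permutation
of `D`. -/
theorem RowEquiv.exists_perm_of_eqOn {t u : Tableau μ κ} (h : RowEquiv t u) {D : Finset (Box μ)}
    (hD : ∀ c, c ∉ D → t c = u c) :
    ∃ σ ∈ rowPerms μ, (∀ c, c ∉ D → σ c = c) ∧ place t σ = u := by
  classical
  obtain ⟨τ, hτ, rfl⟩ := h
  have hcard : ∀ y : ℕ × κ, (D.filter fun c => (c.row, t c) = y).card =
      (D.filter fun c => (c.row, place t τ c) = y).card := by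
    intro y
    have h1 : (Finset.univ.filter fun c : Box μ => (c.row, t c) = y).card =
        (Finset.univ.filter fun c : Box μ => (c.row, place t τ c) = y).card := by
      refine Finset.card_equiv τ fun c => ?_
      simp [hτ c]
    have h2 : (Dᶜ.filter fun c => (c.row, t c) = y) =
        (Dᶜ.filter fun c => (c.row, place t τ c) = y) := by
      refine Finset.filter_congr fun c hc => ?_
      rw [hD c (by simpa using hc)]
    have h3 : ∀ f : Box μ → ℕ × κ, (Finset.univ.filter fun c => f c = y).card =
        (D.filter fun c => f c = y).card + (Dᶜ.filter fun c => f c = y).card := by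
      intro f
      rw [← Finset.card_union_of_disjoint, ← Finset.filter_union, Finset.union_compl]
      exact Finset.disjoint_filter_filter disjoint_compl_right
    rw [h3, h3, h2] at h1
    exact Nat.add_right_cancel h1
  obtain ⟨σ, hσ, hσ'⟩ := exists_perm_of_card_filter_eq D _ _ hcard
  refine ⟨σ, fun c => ?_, hσ, place_eq_iff.2 fun c => ?_⟩
  · by_cases hc : c ∈ D
    · exact (Prod.ext_iff.1 (hσ' c hc)).1
    · rw [hσ c hc]
  · by_cases hc : c ∈ D
    · exact (Prod.ext_iff.1 (hσ' c hc)).2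
    · rw [hσ c hc, hD c hc]

theorem rowEquiv_of_card [DecidableEq κ] {t u : Tableau μ κ}
    (h : ∀ r x, (Finset.univ.filter fun c : Box μ => c.row = r ∧ t c = x).card =
      (Finset.univ.filter fun c : Box μ => c.row = r ∧ u c = x).card) : RowEquiv t u := by
  obtain ⟨σ, -, hσ⟩ := exists_perm_of_card_filter_eq Finset.univ
    (fun c : Box μ => (c.row, t c)) (fun c => (c.row, u c)) (fun y => by
      simpa [Prod.ext_iff] using h y.1 y.2)
  exact ⟨σ, fun c => (Prod.ext_iff.1 (hσ c (Finset.mem_univ _))).1,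
    place_eq_iff.2 fun c => (Prod.ext_iff.1 (hσ c (Finset.mem_univ _))).2⟩

theorem Box.ext_row_col {c d : Box μ} (h1 : c.row = d.row) (h2 : c.col = d.col) : c = d :=
  Subtype.ext (Prod.ext h1 h2)

theorem Box.col_lt_rowLen (c : Box μ) : c.col < μ.rowLen c.row :=
  YoungDiagram.mem_iff_lt_rowLen.mp c.2

theorem Box.row_lt_colLen (c : Box μ) : c.row < μ.colLen c.col :=
  YoungDiagram.mem_iff_lt_colLen.mp c.2

/-- The rows of `t` weakly increase. -/
def RowsIncrease [LinearOrder κ] (t : Tableau μ κ) : Prop :=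
  ∀ c d : Box μ, c.row = d.row → c.col < d.col → t c ≤ t d

theorem swap_mem_rowPerms {c d : Box μ} (h : c.row = d.row) :
    Equiv.swap c d ∈ rowPerms μ := by
  intro x
  by_cases hc : x = c
  · subst hc; simp [h]
  by_cases hd : x = d
  · subst hd; simp [h]
  rw [Equiv.swap_apply_of_ne_of_ne hc hd]

/-- Every tableau is row equivalent to one with weakly increasing rows. -/
theorem exists_rowEquiv_rowsIncrease [LinearOrder κ] {e : κ → ℤ} (he : StrictMono e)
    (t : Tableau μ κ) : ∃ u, RowEquiv t u ∧ RowsIncrease u := by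
  -- maximise `∑ c, c.col * e (u c)` on the row orbit: sorting a descent would increase it
  obtain ⟨u, hu, hmax⟩ := (rowOrbit t).exists_max_image
    (fun u => ∑ c : Box μ, (c.col : ℤ) * e (u c)) ⟨t, mem_rowOrbit.2 (.refl t)⟩
  refine ⟨u, mem_rowOrbit.1 hu, fun c d hr hcd => ?_⟩
  by_contra! hlt
  have hne : c ≠ d := fun h => by simp [h] at hcd
  have h := hmax _ (place_mem_rowOrbit (swap_mem_rowPerms hr) hu)
  rw [← Equiv.sum_comp (Equiv.swap c d), ← sub_nonneg, ← Finset.sum_sub_distrib] at h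
  simp only [place_apply_apply, ← sub_mul] at h
  rw [Fintype.sum_eq_add c d hne] at h
  · rw [Equiv.swap_apply_left, Equiv.swap_apply_right] at h
    have h1 := he hlt
    have h2 : (c.col : ℤ) < d.col := by exact_mod_cast hcd
    nlinarith
  · rintro x ⟨hx, hx'⟩
    simp [Equiv.swap_apply_of_ne_of_ne hx hx']

theorem RowEquiv.card_filter_le_eq [LinearOrder κ] {t u : Tableau μ κ} (h : RowEquiv t u)
    (r : ℕ) (x : κ) :
    (Finset.univ.filter fun c : Box μ => c.row = r ∧ t c ≤ x).card =
      (Finset.univ.filter fun c : Box μ => c.row = r ∧ u c ≤ x).card := by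
  obtain ⟨σ, hσ, rfl⟩ := h
  exact Finset.card_equiv σ fun c => by simp [hσ c]

theorem RowEquiv.le_of_rowsIncrease [LinearOrder κ] {t u : Tableau μ κ} (h : RowEquiv t u)
    (ht : RowsIncrease t) (hu : RowsIncrease u) (c : Box μ) : u c ≤ t c := by
  by_contra! hlt
  -- row `c.row` of `t` has more entries `≤ t c` than that of `u`
  refine (Finset.card_lt_card ?_).ne (h.card_filter_le_eq c.row (t c)).symm
  rw [Finset.ssubset_iff_of_subset]
  · exact ⟨c, by simp, by simpa using hlt⟩
  · intro d hd
    simp only [Finset.mem_filter, Finset.mem_univ, true_and] at hd ⊢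
    refine ⟨hd.1, ?_⟩
    rcases lt_trichotomy d.col c.col with h1 | h1 | h1
    · exact ht _ _ hd.1 h1
    · rw [Box.ext_row_col hd.1 h1]
    · exact absurd ((hu _ _ hd.1.symm h1).trans hd.2) hlt.not_ge

theorem RowEquiv.eq_of_rowsIncrease [LinearOrder κ] {t u : Tableau μ κ} (h : RowEquiv t u)
    (ht : RowsIncrease t) (hu : RowsIncrease u) : t = u :=
  funext fun c => le_antisymm (h.symm.le_of_rowsIncrease hu ht c) (h.le_of_rowsIncrease ht hu c)

/-! ### The weight of a tableau -/

/-- The sum of the entries of `t`, read as integers through `e`, each multiplied by the number of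
its row. It is invariant under row permutations and measures how far large entries have moved
down. -/
def weight (e : κ → ℤ) (t : Tableau μ κ) : ℤ := ∑ c : Box μ, (c.row : ℤ) * e (t c)

theorem weight_place (e : κ → ℤ) (t : Tableau μ κ) (σ : Equiv.Perm (Box μ)) :
    weight e (place t σ) = ∑ c : Box μ, ((σ c).row : ℤ) * e (t c) := by
  rw [weight, ← Equiv.sum_comp σ]
  simp

theorem RowEquiv.weight_eq (e : κ → ℤ) {t u : Tableau μ κ} (h : RowEquiv t u) :
    weight e t = weight e u := by
  obtain ⟨σ, hσ, rfl⟩ := h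
  rw [weight_place, weight]
  exact Finset.sum_congr rfl fun c _ => by rw [hσ c]

/-- Let `A` and `B` be sets of boxes in the rows `i < i'`, such that the entries of `t` in `A` are
at least `x` and those in `B` are at most `x`. Permuting the entries in `A ∪ B` increases the
weight of `t`, unless the result is row equivalent to `t`. -/
theorem rowEquiv_or_weight_lt [LinearOrder κ] {e : κ → ℤ} (he : StrictMono e)
    {t u : Tableau μ κ} {A B : Finset (Box μ)} {i i' : ℕ} (hi : i < i') {x : κ}
    (hA : ∀ c ∈ A, c.row = i ∧ x ≤ t c) (hB : ∀ c ∈ B, c.row = i' ∧ t c ≤ x)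
    (hu : u ∈ permutedIn t (A ∪ B)) : RowEquiv t u ∨ weight e t < weight e u := by
  obtain ⟨τ, hτ, rfl⟩ := hu
  have hmem : ∀ c, c ∈ A ∪ B → τ c ∈ A ∪ B := by
    intro c hc
    by_contra h
    exact h (by rwa [τ.injective (hτ _ h)])
  have hrow : ∀ c, c ∈ A ∪ B → c.row = i ∨ c.row = i' := by
    intro c hc
    rcases Finset.mem_union.1 hc with h | h
    · exact .inl (hA c h).1
    · exact .inr (hB c h).1
  -- `τ` preserves the sum of all row numbers, so `e x` may be subtracted from every entry
  have hsum : weight e (place t τ) - weight e t =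
      ∑ c : Box μ, (((τ c).row : ℤ) - c.row) * (e (t c) - e x) := by
    have h0 : ∑ c : Box μ, (((τ c).row : ℤ) - c.row) = 0 := by
      rw [Finset.sum_sub_distrib, Equiv.sum_comp τ fun c : Box μ => (c.row : ℤ), sub_self]
    rw [weight_place, weight, ← Finset.sum_sub_distrib]
    rw [← sub_zero (∑ c : Box μ, _), ← zero_mul (e x), ← h0, Finset.sum_mul,
      ← Finset.sum_sub_distrib]
    exact Finset.sum_congr rfl fun c _ => by ring
  have hnn : ∀ c : Box μ, 0 ≤ (((τ c).row : ℤ) - c.row) * (e (t c) - e x) := by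
    intro c
    by_cases hc : c ∈ A ∪ B
    · have h2 := hrow _ (hmem c hc)
      rcases Finset.mem_union.1 hc with h | h
      · have h1 := hA c h
        have := he.monotone h1.2
        refine mul_nonneg ?_ (by linarith)
        omega
      · have h1 := hB c h
        have := he.monotone h1.2
        refine mul_nonneg_of_nonpos_of_nonpos ?_ (by linarith)
        omega
    · simp [hτ c hc]
  rcases (Finset.sum_nonneg fun c (_ : c ∈ Finset.univ) => hnn c).lt_or_eq with hlt | heq
  · right
    linarith
  left
  have hx : ∀ c, t c ≠ x → (τ c).row = c.row := by
    intro c hc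
    have h := (Finset.sum_eq_zero_iff_of_nonneg fun c _ => hnn c).1 heq.symm c (Finset.mem_univ c)
    rcases mul_eq_zero.1 h with h | h
    · omega
    · exact absurd (he.injective (sub_eq_zero.1 h)) hc
  -- only entries equal to `x` change their row, so the other entries keep their multiplicities
  have hp : ∀ (r : ℕ) (p : κ → Prop) [DecidablePred p], ¬ p x →
      (Finset.univ.filter fun c : Box μ => c.row = r ∧ p (t c)).card =
      (Finset.univ.filter fun c : Box μ => c.row = r ∧ p (place t τ c)).card := by
    intro r p _ hpx
    refine Finset.card_equiv τ fun c => ?_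
    simp only [Finset.mem_filter, Finset.mem_univ, true_and, place_apply_apply]
    refine and_congr_left fun hc => ?_
    rw [hx c fun h => hpx (h ▸ hc)]
  refine rowEquiv_of_card fun r y => ?_
  by_cases hy : y = x
  · subst hy
    have h1 := hp r (fun z => z ≠ y) (by simp)
    have h2 : ∀ v : Tableau μ κ, (Finset.univ.filter fun c : Box μ => c.row = r).card =
        (Finset.univ.filter fun c : Box μ => c.row = r ∧ v c = y).card +
        (Finset.univ.filter fun c : Box μ => c.row = r ∧ v c ≠ y).card := by
      intro v
      rw [← Finset.filter_filter, ← Finset.filter_filter]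
      exact (Finset.card_filter_add_card_filter_not _).symm
    have h3 := h2 t
    have h4 := h2 (place t τ)
    omega
  · exact hp r (fun z => z = y) (Ne.symm hy)

end Combinatorics

end Weyl

/-! ### Dual Garnir relations lie in the kernel -/

namespace Weyl

section Garnir

variable {R : Type*} [CommRing R] {V : Type*} [AddCommGroup V] [Module R V] {κ : Type*}
  {μ : YoungDiagram} (b : Module.Basis κ R V)

theorem exists_colBoxEquiv_of_col_eq {c d : Box μ} (h : c.col = d.col) :
    ∃ (j : Fin (μ.rowLen 0)) (i i' : Fin (μ.colLen j)),
      c = colBoxEquiv μ ⟨j, i⟩ ∧ d = colBoxEquiv μ ⟨j, i'⟩ := by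
  obtain ⟨⟨j, i⟩, rfl⟩ := (colBoxEquiv μ).surjective c
  obtain ⟨⟨j', i'⟩, rfl⟩ := (colBoxEquiv μ).surjective d
  obtain rfl : j = j' := Fin.ext h
  exact ⟨j, i, i', rfl, rfl⟩

theorem colTabloid_eq_zero {t : Tableau μ κ} {c d : Box μ} (hne : c ≠ d) (hcol : c.col = d.col)
    (h : t c = t d) : colTabloid b t = 0 := by
  obtain ⟨j, i, i', rfl, rfl⟩ := exists_colBoxEquiv_of_col_eq hcol
  refine MultilinearMap.map_coord_zero _ j ?_
  exact AlternatingMap.map_eq_zero_of_eq _ _ (i := i) (j := i') (by rw [h])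
    fun hi => hne (by rw [hi])

theorem colTabloid_place_swap (t : Tableau μ κ) {c d : Box μ} (hne : c ≠ d)
    (hcol : c.col = d.col) : colTabloid b (place t (Equiv.swap c d)) = -colTabloid b t := by
  obtain ⟨j, i, i', rfl, rfl⟩ := exists_colBoxEquiv_of_col_eq hcol
  have hii : i ≠ i' := fun hi => hne (by rw [hi])
  have hfam : (fun j' : Fin (μ.rowLen 0) => exteriorPower.ιMulti R (μ.colLen j')
      (fun k : Fin (μ.colLen j') => b (place t (Equiv.swap (colBoxEquiv μ ⟨j, i⟩)
        (colBoxEquiv μ ⟨j, i'⟩)) (colBoxEquiv μ ⟨j', k⟩)))) =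
      Function.update (fun j' : Fin (μ.rowLen 0) => exteriorPower.ιMulti R (μ.colLen j')
        (fun k : Fin (μ.colLen j') => b (t (colBoxEquiv μ ⟨j', k⟩)))) j
        (-exteriorPower.ιMulti R (μ.colLen j)
          (fun k : Fin (μ.colLen j) => b (t (colBoxEquiv μ ⟨j, k⟩)))) := by
    funext j'
    by_cases hj : j' = j
    · subst hj
      rw [Function.update_self, ← AlternatingMap.map_swap _ _ hii]
      congr 1
      funext k
      simp only [place, Equiv.symm_swap, Function.comp_apply]
      congr 2
      rw [Equiv.swap_apply_def, Equiv.swap_apply_def]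
      simp only [EmbeddingLike.apply_eq_iff_eq, Sigma.mk.injEq, heq_eq_eq, true_and]
      split_ifs <;> rfl
    · rw [Function.update_of_ne hj]
      congr 1
      funext k
      simp only [place, Equiv.symm_swap]
      rw [Equiv.swap_apply_of_ne_of_ne]
      · simp [hj]
      · simp [hj]
  refine (congrArg (PiTensorProduct.tprod R) hfam).trans
    ((MultilinearMap.map_update_neg (PiTensorProduct.tprod R) _ j _).trans ?_)
  rw [Function.update_eq_self]
  rfl

open scoped Pointwise

/-- The index occurring in a dual Garnir relation counts, by the orbit-stabiliser theorem, the
images of `D` under the row stabiliser. -/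
theorem relIndex_splitPerms_rowStab (t : Tableau μ κ) (D : Finset (Box μ)) [DecidablePred
    fun E : Finset (Box μ) => ∃ σ ∈ rowPerms μ, σ • D = E ∧ place t σ = t] :
    (splitPerms D).relIndex (rowStab t) = (Finset.univ.filter fun E : Finset (Box μ) =>
      ∃ σ ∈ rowPerms μ, σ • D = E ∧ place t σ = t).card := by
  have h : (splitPerms D).subgroupOf (rowStab t) = MulAction.stabilizer (rowStab t) D := by
    ext σ
    rw [Subgroup.mem_subgroupOf, MulAction.mem_stabilizer_iff]
    constructor
    · intro hσ
      refine Finset.eq_of_subset_of_card_le (fun c hc => ?_) (Finset.card_smul_finset _ _).ge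
      obtain ⟨d, hd, rfl⟩ := Finset.mem_smul_finset.1 hc
      exact (hσ d).2 hd
    · intro hσ c
      have h1 := Finset.smul_mem_smul_finset_iff (s := D) (b := c) (σ : Equiv.Perm (Box μ))
      have h2 : (σ : Equiv.Perm (Box μ)) • D = D := hσ
      rwa [h2] at h1
  rw [Subgroup.relIndex, h, MulAction.index_stabilizer, ← Set.ncard_coe_finset]
  congr 1
  ext E
  simp only [MulAction.mem_orbit_iff, Finset.coe_filter, Finset.mem_univ, true_and,
    Set.mem_ofPred_eq]
  constructor
  · rintro ⟨σ, rfl⟩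
    exact ⟨σ, σ.2.1, rfl, σ.2.2⟩
  · rintro ⟨σ, h1, rfl, h2⟩
    exact ⟨⟨σ, h1, h2⟩, rfl⟩

/-- The index in a dual Garnir relation counted at any tableau of the row orbit. -/
theorem RowEquiv.relIndex_splitPerms_rowStab {t u : Tableau μ κ} (h : RowEquiv t u)
    (D : Finset (Box μ)) [DecidablePred
    fun E : Finset (Box μ) => ∃ σ ∈ rowPerms μ, σ • D = E ∧ place t σ = u] :
    (splitPerms D).relIndex (rowStab t) = (Finset.univ.filter fun E : Finset (Box μ) =>
      ∃ σ ∈ rowPerms μ, σ • D = E ∧ place t σ = u).card := by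
  classical
  obtain ⟨τ, hτ, rfl⟩ := h
  rw [Weyl.relIndex_splitPerms_rowStab]
  refine Finset.card_equiv (MulAction.toPerm τ) fun E => ?_
  simp only [Finset.mem_filter, Finset.mem_univ, true_and, MulAction.toPerm_apply]
  constructor
  · rintro ⟨σ, hσ, rfl, h⟩
    exact ⟨τ * σ, (rowPerms μ).mul_mem hτ hσ, mul_smul _ _ _, by rw [place_mul, h]⟩
  · rintro ⟨σ, hσ, hE, h⟩
    refine ⟨τ⁻¹ * σ, (rowPerms μ).mul_mem ((rowPerms μ).inv_mem hτ) hσ, ?_, ?_⟩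
    · rw [mul_smul, hE, inv_smul_smul]
    · rw [place_mul, h, ← place_mul, inv_mul_cancel]
      rfl

theorem eq_of_mem_permutedIn {t u : Tableau μ κ} {D : Finset (Box μ)} (hu : u ∈ permutedIn t D)
    {c : Box μ} (hc : c ∉ D) : u c = t c := by
  obtain ⟨τ, hτ, rfl⟩ := hu
  conv_lhs => rw [← hτ c hc]
  simp

/-- A set of more than `μ.rowLen i` boxes in the rows `i < i'` contains two boxes in one
column. -/
theorem exists_col_eq {i i' : ℕ} (hi : i < i') {E : Finset (Box μ)}
    (hE : ∀ c ∈ E, c.row = i ∨ c.row = i') (hcard : μ.rowLen i < E.card) :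
    ∃ c ∈ E, ∃ d ∈ E, c ≠ d ∧ c.col = d.col := by
  refine Finset.exists_ne_map_eq_of_card_lt_of_maps_to (t := Finset.range (μ.rowLen i))
    (by simpa using hcard) fun c hc => ?_
  simp only [Finset.coe_range, Set.mem_Iio]
  refine c.col_lt_rowLen.trans_le ?_
  rcases hE c hc with h | h
  · rw [h]
  · rw [h]
    exact μ.rowLen_anti _ _ hi.le

/-- The terms of a dual Garnir relation attached to one image `E` of the set `A ∪ B` cancel in
pairs: swapping two boxes of `E` in a common column is a sign-reversing involution. -/
theorem sum_colTabloid_eq_zero [Fintype κ] {t : Tableau μ κ} {i i' : ℕ}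
    (hi : i < i') {D : Finset (Box μ)} (hD : ∀ c ∈ D, c.row = i ∨ c.row = i')
    (hcard : μ.rowLen i < D.card) {S : Finset (Tableau μ κ)}
    (hS : IsRowTransversal (permutedIn t D) S) (E : Finset (Box μ)) [DecidablePred
      fun v : Tableau μ κ => ∃ s ∈ S, ∃ σ ∈ rowPerms μ, σ • D = E ∧ place s σ = v] :
    ∑ v ∈ Finset.univ.filter fun v : Tableau μ κ =>
      ∃ s ∈ S, ∃ σ ∈ rowPerms μ, σ • D = E ∧ place s σ = v, colTabloid b v = 0 := by
  by_cases hex : ∃ σ ∈ rowPerms μ, σ • D = E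
  swap
  · refine Finset.sum_eq_zero fun v hv => ?_
    simp only [Finset.mem_filter, Finset.mem_univ, true_and] at hv
    obtain ⟨s, -, σ, hσ, hE, -⟩ := hv
    exact absurd ⟨σ, hσ, hE⟩ hex
  have hE : ∃ c ∈ E, ∃ d ∈ E, c ≠ d ∧ c.col = d.col := by
    obtain ⟨σ, hσ, rfl⟩ := hex
    refine exists_col_eq hi (fun c hc => ?_) (by rwa [Finset.card_smul_finset])
    obtain ⟨d, hd, rfl⟩ := Finset.mem_smul_finset.1 hc
    rw [Equiv.Perm.smul_def, hσ d]
    exact hD d hd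
  obtain ⟨c, hc, d, hd, hne, hcol⟩ := hE
  refine Finset.sum_involution (fun v _ => place v (Equiv.swap c d)) ?_ ?_ ?_ ?_
  · intro v _
    rw [colTabloid_place_swap b v hne hcol, add_neg_cancel]
  · intro v _ hv h
    refine hv (colTabloid_eq_zero b hne hcol ?_)
    conv_rhs => rw [← h]
    simp [place]
  · intro v hv
    simp only [Finset.mem_filter, Finset.mem_univ, true_and] at hv ⊢
    obtain ⟨s, hs, σ, hσ, rfl, rfl⟩ := hv
    obtain ⟨c', hc', rfl⟩ := Finset.mem_smul_finset.1 hc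
    obtain ⟨d', hd', rfl⟩ := Finset.mem_smul_finset.1 hd
    -- conjugating the swap by `σ` gives a swap within `D`
    have hswap : Equiv.swap (σ • c') (σ • d') * σ = σ * Equiv.swap c' d' := by
      ext1 x
      simp [Equiv.swap_apply_apply]
    have hsT := hS.1 s hs
    have hw : place s (Equiv.swap c' d') ∈ permutedIn t D := by
      obtain ⟨τ, hτ, rfl⟩ := hsT
      refine ⟨Equiv.swap c' d' * τ, fun x hx => ?_, rfl⟩
      rw [Equiv.Perm.mul_apply, hτ x hx, Equiv.swap_apply_of_ne_of_ne]
      · rintro rfl; exact hx hc'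
      · rintro rfl; exact hx hd'
    obtain ⟨s', ⟨hs', hrow⟩, -⟩ := hS.2 _ hw
    obtain ⟨ρ, hρ, hρD, hρs⟩ := hrow.exists_perm_of_eqOn (D := D) fun x hx => by
      rw [eq_of_mem_permutedIn (hS.1 s' hs') hx, eq_of_mem_permutedIn hw hx]
    refine ⟨s', hs', σ * ρ, (rowPerms μ).mul_mem hσ hρ, ?_, ?_⟩
    · rw [mul_smul]
      congr 1
      refine Finset.eq_of_subset_of_card_le (fun x hx => ?_) (Finset.card_smul_finset _ _).ge
      obtain ⟨y, hy, rfl⟩ := Finset.mem_smul_finset.1 hx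
      by_contra h
      exact h (by rwa [Equiv.Perm.smul_def, ρ.injective (hρD _ h)])
    · rw [place_mul, hρs, ← place_mul, ← place_mul, hswap]
  · intro v _
    rw [← place_mul, Equiv.swap_mul_self]
    rfl

variable (R V μ) in
/-- The restriction of the projection `colProj` to the row-symmetric tensors. -/
def symProj : lowerSym R V μ →ₗ[R] ColWedge R V μ := (colProj R V μ).comp (lowerSym R V μ).subtype

theorem symProj_rsym (t : Tableau μ κ) : symProj R V μ (rsym b t) = copolytabloid b t := by
  simp only [symProj, rsym, copolytabloid, LinearMap.comp_apply, Submodule.subtype_apply, map_sum,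
    tabTensor, colProj_tprod, colTabloid]

/-- The dual Garnir relations lie in the kernel of the projection to the exterior powers. -/
theorem symProj_garnirSum [Finite κ] {t : Tableau μ κ} {i i' : ℕ}
    (hi : i < i') {D : Finset (Box μ)} (hD : ∀ c ∈ D, c.row = i ∨ c.row = i')
    (hcard : μ.rowLen i < D.card) {S : Finset (Tableau μ κ)}
    (hS : IsRowTransversal (permutedIn t D) S) :
    symProj R V μ (garnirSum b D S) = 0 := by
  classical
  have := Fintype.ofFinite κ
  let P : Tableau μ κ → Tableau μ κ → Finset (Box μ) → Prop := fun s v E =>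
    ∃ σ ∈ rowPerms μ, σ • D = E ∧ place s σ = v
  have hP : ∀ {s v E}, P s v E → RowEquiv s v := fun ⟨σ, hσ, _, h⟩ => ⟨σ, hσ, h⟩
  calc symProj R V μ (garnirSum b D S)
      = ∑ s ∈ S, (splitPerms D).relIndex (rowStab s) • copolytabloid b s := by
        rw [garnirSum, map_sum]
        refine Finset.sum_congr rfl fun s _ => ?_
        rw [← symProj_rsym]
        exact map_nsmul (symProj R V μ) _ _
    _ = ∑ s ∈ S, ∑ v : Tableau μ κ, ∑ E : Finset (Box μ),
          if P s v E then colTabloid b v else 0 := by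
        refine Finset.sum_congr rfl fun s _ => ?_
        rw [copolytabloid, ← Finset.sum_nsmul]
        rw [← Finset.sum_subset (Finset.subset_univ (rowOrbit s))]
        · refine Finset.sum_congr rfl fun v hv => ?_
          rw [(mem_rowOrbit.1 hv).relIndex_splitPerms_rowStab, ← Finset.sum_filter,
            Finset.sum_const]
        · intro v _ hv
          refine Finset.sum_eq_zero fun E _ => if_neg fun h => hv (mem_rowOrbit.2 (hP h))
    _ = ∑ E : Finset (Box μ), ∑ v : Tableau μ κ, ∑ s ∈ S,
          if P s v E then colTabloid b v else 0 := by
        rw [Finset.sum_comm]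
        simp_rw [Finset.sum_comm (s := S)]
        rw [Finset.sum_comm]
    _ = ∑ E : Finset (Box μ), ∑ v : Tableau μ κ,
          if ∃ s ∈ S, P s v E then colTabloid b v else 0 := by
        refine Finset.sum_congr rfl fun E _ => Finset.sum_congr rfl fun v _ => ?_
        split_ifs with h
        · obtain ⟨s, hs, hsv⟩ := h
          rw [Finset.sum_eq_single_of_mem s hs, if_pos hsv]
          intro s' hs' hne
          refine if_neg fun h => hne ?_
          exact (hS.2 s (hS.1 s hs)).unique ⟨hs', (hP h).trans (hP hsv).symm⟩ ⟨hs, .refl s⟩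
        · exact Finset.sum_eq_zero fun s hs => if_neg fun hP => h ⟨s, hs, hP⟩
    _ = 0 := by
        refine Finset.sum_eq_zero fun E _ => ?_
        rw [← Finset.sum_filter]
        exact sum_colTabloid_eq_zero b hi hD hcard hS E

theorem dualGarnir_le_ker_symProj [Finite κ] :
    dualGarnir μ b ≤ LinearMap.ker (symProj R V μ) := by
  refine Submodule.span_le.2 ?_
  rintro _ ⟨t, A, B, ⟨i, i', hi, -, hA, hB, hcard⟩, S, hS, rfl⟩
  refine symProj_garnirSum b hi (fun c hc => ?_) ?_ hS
  · exact (Finset.mem_union.1 hc).imp (hA c) (hB c)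
  · rwa [Finset.card_union_of_disjoint]
    exact Finset.disjoint_left.2 fun c h1 h2 => hi.ne ((hA c h1).symm.trans (hB c h2))

end Garnir

end Weyl

/-! ### Straightening -/

namespace Weyl

section Straightening

variable {R : Type*} [CommRing R] {V : Type*} [AddCommGroup V] [Module R V] {κ : Type*}
  {μ : YoungDiagram} (b : Module.Basis κ R V)

theorem RowEquiv.rsym_eq {t u : Tableau μ κ} (h : RowEquiv t u) : rsym b t = rsym b u :=
  Subtype.ext (by simp only [rsym, h.rowOrbit_eq])

theorem repr_reindex_place (σ : Equiv.Perm (Box μ)) (x : TensorPow R V μ) (t : Tableau μ κ) :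
    (Basis.piTensorProduct fun _ : Box μ => b).repr
        (PiTensorProduct.reindex R (fun _ : Box μ => V) σ x) (place t σ) =
      (Basis.piTensorProduct fun _ : Box μ => b).repr x t := by
  classical
  let B := Basis.piTensorProduct fun _ : Box μ => b
  have h : Finsupp.lapply (place t σ) ∘ₗ B.repr.toLinearMap ∘ₗ
      (PiTensorProduct.reindex R (fun _ : Box μ => V) σ).toLinearMap =
      Finsupp.lapply t ∘ₗ B.repr.toLinearMap := by
    refine B.ext fun u => ?_
    have h1 : PiTensorProduct.reindex R (fun _ : Box μ => V) σ (B u) = B (place u σ) := by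
      simp only [B, Basis.piTensorProduct_apply]
      exact reindex_tabTensor b σ u
    simp only [LinearMap.comp_apply, LinearEquiv.coe_coe, Finsupp.lapply_apply]
    rw [h1, B.repr_self, B.repr_self, Finsupp.single_apply, Finsupp.single_apply]
    simp only [(place_injective σ).eq_iff]
  exact LinearMap.congr_fun h x

/-- The coefficients of a row-symmetric tensor are constant on row orbits, so that it is a
combination of row symmetrisations. -/
theorem span_rsym [Finite κ] :
    Submodule.span R (Set.range (rsym b : Tableau μ κ → lowerSym R V μ)) = ⊤ := by
  classical
  have := Fintype.ofFinite κ
  refine Submodule.eq_top_iff'.2 fun x => ?_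
  let B := Basis.piTensorProduct fun _ : Box μ => b
  let a : Tableau μ κ → R := fun t => B.repr (x : TensorPow R V μ) t
  have ha : ∀ {t u : Tableau μ κ}, RowEquiv t u → a t = a u := by
    rintro t _ ⟨σ, hσ, rfl⟩
    have h := repr_reindex_place b σ (x : TensorPow R V μ) t
    rw [x.2 σ hσ] at h
    exact h.symm
  let mk : Tableau μ κ → Quotient (rowSetoid μ κ) := Quotient.mk _
  have hx : x = ∑ q : Quotient (rowSetoid μ κ), a q.out • rsym b q.out := by
    refine Subtype.ext ?_
    rw [Submodule.coe_sum, ← B.sum_repr (x : TensorPow R V μ), ← Finset.sum_fiberwise _ mk]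
    refine Finset.sum_congr rfl fun q _ => ?_
    rw [Submodule.coe_smul]
    simp only [rsym]
    rw [Finset.smul_sum]
    refine Finset.sum_congr ?_ fun t ht => ?_
    · ext t
      rw [mem_rowOrbit, Finset.mem_filter_univ]
      constructor
      · rintro rfl
        exact Quotient.exact (s := rowSetoid μ κ) (Quotient.out_eq _)
      · intro h
        exact (Quotient.sound (s := rowSetoid μ κ) h.symm).trans (Quotient.out_eq q)
    · rw [ha (mem_rowOrbit.1 ht)]
      congr 1
      exact Basis.piTensorProduct_apply _ _
  rw [hx]
  exact Submodule.sum_mem _ fun q _ => Submodule.smul_mem _ _ (Submodule.subset_span ⟨_, rfl⟩)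

/-- If the rows of `t` increase weakly, and a box `c` contains an entry at least as large as that
of a lower box `d` of its column, the boxes in the row of `c` with entries `≥ t c` and those in
the row of `d` with entries `≤ t d` are together more than `μ.rowLen c.row`. -/
theorem rowLen_lt_card_add_card [LinearOrder κ] {t : Tableau μ κ} (ht : RowsIncrease t)
    {c d : Box μ} (hcol : c.col = d.col) :
    μ.rowLen c.row < (Finset.univ.filter fun a : Box μ => a.row = c.row ∧ t c ≤ t a).card +
      (Finset.univ.filter fun a : Box μ => a.row = d.row ∧ t a ≤ t d).card := by
  have h1 : μ.rowLen c.row - c.col ≤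
      (Finset.univ.filter fun a : Box μ => a.row = c.row ∧ t c ≤ t a).card := by
    rw [← Nat.card_Ico, ← Finset.card_image_of_injOn (f := Box.col) (s := Finset.univ.filter _)]
    · refine Finset.card_le_card fun k hk => ?_
      rw [Finset.mem_Ico] at hk
      have hmem : (c.row, k) ∈ μ.cells := YoungDiagram.mem_iff_lt_rowLen.mpr hk.2
      refine Finset.mem_image.2 ⟨⟨_, hmem⟩, ?_, rfl⟩
      refine Finset.mem_filter.2 ⟨Finset.mem_univ _, rfl, ?_⟩
      rcases hk.1.lt_or_eq with h | h
      · exact ht c ⟨_, hmem⟩ rfl h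
      · exact (congrArg t (Box.ext_row_col (c := c) (d := ⟨(c.row, k), hmem⟩) rfl h)).le
    · intro a ha a' ha' h
      simp only [Finset.coe_filter, Finset.mem_univ, true_and, Set.mem_ofPred_eq] at ha ha'
      exact Box.ext_row_col (ha.1.trans ha'.1.symm) h
  have h2 : d.col + 1 ≤
      (Finset.univ.filter fun a : Box μ => a.row = d.row ∧ t a ≤ t d).card := by
    rw [← Finset.card_range (d.col + 1),
      ← Finset.card_image_of_injOn (f := Box.col) (s := Finset.univ.filter _)]
    · refine Finset.card_le_card fun k hk => ?_
      rw [Finset.mem_range, Nat.lt_succ_iff] at hk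
      have hmem : (d.row, k) ∈ μ.cells :=
        YoungDiagram.mem_iff_lt_rowLen.mpr (hk.trans_lt d.col_lt_rowLen)
      refine Finset.mem_image.2 ⟨⟨_, hmem⟩, ?_, rfl⟩
      refine Finset.mem_filter.2 ⟨Finset.mem_univ _, rfl, ?_⟩
      rcases hk.lt_or_eq with h | h
      · exact ht ⟨_, hmem⟩ d rfl h
      · exact (congrArg t (Box.ext_row_col (c := ⟨(d.row, k), hmem⟩) (d := d) rfl h)).le
    · intro a ha a' ha' h
      simp only [Finset.coe_filter, Finset.mem_univ, true_and, Set.mem_ofPred_eq] at ha ha'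
      exact Box.ext_row_col (ha.1.trans ha'.1.symm) h
  have := c.col_lt_rowLen
  omega

/-- Straightening: modulo the dual Garnir relations, the row symmetrisation of a row-increasing
tableau that is not semistandard is a combination of row symmetrisations of tableaux of larger
weight. -/
theorem rsym_mem_of_forall_weight_lt [LinearOrder κ] [Finite κ] {e : κ → ℤ} (he : StrictMono e)
    {P : Submodule R (lowerSym R V μ)} (hP : dualGarnir μ b ≤ P) {t : Tableau μ κ}
    (ht : RowsIncrease t) (hss : ¬ IsSemistandard t)
    (ih : ∀ u : Tableau μ κ, weight e t < weight e u → rsym b u ∈ P) : rsym b t ∈ P := by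
  classical
  obtain ⟨c, d, hcol, hrow, hle⟩ : ∃ c d : Box μ, c.col = d.col ∧ c.row < d.row ∧ t d ≤ t c := by
    by_contra! h
    exact hss ⟨ht, h⟩
  let A : Finset (Box μ) := Finset.univ.filter fun a => a.row = c.row ∧ t c ≤ t a
  let B : Finset (Box μ) := Finset.univ.filter fun a => a.row = d.row ∧ t a ≤ t d
  have hA : ∀ a ∈ A, a.row = c.row ∧ t c ≤ t a := fun a ha => by simpa [A] using ha
  have hB : ∀ a ∈ B, a.row = d.row ∧ t a ≤ t d := fun a ha => by simpa [B] using ha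
  have htT : t ∈ permutedIn t (A ∪ B) := ⟨1, fun _ _ => rfl, rfl⟩
  obtain ⟨S, hS, htS⟩ := exists_isRowTransversal htT
  have hrel : garnirSum b (A ∪ B) S ∈ P := by
    refine hP (Submodule.subset_span ⟨t, A, B, ⟨c.row, d.row, hrow, ?_, fun a ha => (hA a ha).1,
      fun a ha => (hB a ha).1, rowLen_lt_card_add_card ht hcol⟩, S, hS, rfl⟩)
    exact d.row_lt_colLen.trans_le (μ.colLen_anti _ _ (Nat.zero_le _))
  -- `A` and `B` are unions of level sets of `t` in their rows, so the coefficient of `t` is one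
  have hindex : (splitPerms (A ∪ B)).relIndex (rowStab t) = 1 := by
    refine Subgroup.relIndex_eq_one.2 fun σ hσ a => ?_
    have h1 := hσ.1 a
    have h2 := place_eq_iff.1 hσ.2 a
    simp only [A, B, Finset.mem_union, Finset.mem_filter, Finset.mem_univ, true_and, h1, h2]
  rw [garnirSum, ← Finset.add_sum_erase S _ htS, hindex, one_smul] at hrel
  refine (Submodule.add_mem_iff_left P (Submodule.sum_mem _ fun u hu => ?_)).1 hrel
  rw [← Nat.cast_smul_eq_nsmul R]
  refine Submodule.smul_mem _ _ (ih u ?_)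
  obtain ⟨hne, huS⟩ := Finset.mem_erase.1 hu
  refine (rowEquiv_or_weight_lt he hrow hA (fun a ha => ⟨(hB a ha).1, (hB a ha).2.trans hle⟩)
    (hS.1 u huS)).resolve_left fun h => hne ?_
  exact (hS.2 t htT).unique ⟨huS, h.symm⟩ ⟨htS, .refl t⟩

theorem exists_strictMono_int (κ : Type*) [LinearOrder κ] [Finite κ] :
    ∃ e : κ → ℤ, StrictMono e := by
  have := Fintype.ofFinite κ
  refine ⟨fun x => ((Fintype.orderIsoFinOfCardEq κ rfl).symm x : ℕ), fun x y h => ?_⟩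
  have := (Fintype.orderIsoFinOfCardEq κ rfl).symm.strictMono h
  simpa using this

/-- The semistandard row symmetrisations span the row-symmetric tensors modulo the dual Garnir
relations. -/
theorem span_rsym_semistandard_sup_dualGarnir [LinearOrder κ] [Finite κ] :
    Submodule.span R (Set.range fun s : {t : Tableau μ κ // IsSemistandard t} => rsym b s.1) ⊔
      dualGarnir μ b = ⊤ := by
  classical
  have := Fintype.ofFinite κ
  obtain ⟨e, he⟩ := exists_strictMono_int κ
  set P := Submodule.span R
    (Set.range fun s : {t : Tableau μ κ // IsSemistandard t} => rsym b s.1) ⊔ dualGarnir μ b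
    with hPdef
  rw [← top_le_iff, ← span_rsym b, Submodule.span_le]
  rintro _ ⟨t, rfl⟩
  by_contra ht
  obtain ⟨u, hu, hmax⟩ := (Finset.univ.filter fun u : Tableau μ κ => rsym b u ∉ P).exists_max_image
    (weight e) ⟨t, by simpa using ht⟩
  simp only [Finset.mem_filter, Finset.mem_univ, true_and] at hu hmax
  obtain ⟨v, huv, hv⟩ := exists_rowEquiv_rowsIncrease he u
  rw [huv.rsym_eq b] at hu
  refine hu ?_
  by_cases hss : IsSemistandard v
  · exact Submodule.mem_sup_left (Submodule.subset_span ⟨⟨v, hss⟩, rfl⟩)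
  · refine rsym_mem_of_forall_weight_lt b he le_sup_right hv hss fun w hw => ?_
    by_contra hwP
    have := hmax w hwP
    rw [huv.weight_eq] at this
    exact absurd hw this.not_gt

end Straightening

end Weyl

/-! ### Linear independence of the semistandard copolytabloids -/

namespace Weyl

section Independence

theorem linearIndependent_of_unitriangular {R M ι : Type*} [CommRing R] [AddCommMonoid M]
    [Module R M] [Finite ι] {v : ι → M} (w : ι → ℤ) (φ : ι → M →ₗ[R] R)
    (h1 : ∀ s, φ s (v s) = 1) (h : ∀ s t, φ s (v t) ≠ 0 → t = s ∨ w t < w s) :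
    LinearIndependent R v := by
  classical
  have := Fintype.ofFinite ι
  refine LinearIndependent.of_comp (LinearMap.pi φ) (Fintype.linearIndependent_iff.2 fun a ha => ?_)
  by_contra! hne
  obtain ⟨s, hs, hmin⟩ := (Finset.univ.filter fun s => a s ≠ 0).exists_min_image w
    (by simpa [Finset.Nonempty] using hne)
  simp only [Finset.mem_filter, Finset.mem_univ, true_and] at hs hmin
  have h0 := congrFun ha s
  simp only [Finset.sum_apply, Pi.smul_apply, Function.comp_apply, LinearMap.pi_apply,
    smul_eq_mul, Pi.zero_apply] at h0
  rw [Finset.sum_eq_single s, h1, mul_one] at h0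
  · exact hs h0
  · intro t _ hts
    by_contra hne0
    have h2 := (h s t (right_ne_zero_of_mul hne0)).resolve_left hts
    exact absurd h2 (hmin t (left_ne_zero_of_mul hne0)).not_gt
  · exact fun h => absurd (Finset.mem_univ s) h

variable {R : Type*} [CommRing R] {V : Type*} [AddCommGroup V] [Module R V] {κ : Type*}
  {μ : YoungDiagram} (b : Module.Basis κ R V)

/-- The functional on the tensor product of the exterior powers that sends `colTabloid b u` to the
product over the columns of the determinants of the matrices of scalars `δ (s i) (u i')`, where
`i` and `i'` run through the boxes of the column. -/
noncomputable def colDual (s : Tableau μ κ) : ColWedge R V μ →ₗ[R] R :=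
  PiTensorProduct.dualDistrib (PiTensorProduct.tprod R fun j : Fin (μ.rowLen 0) =>
    exteriorPower.pairingDual R V (μ.colLen j) (exteriorPower.ιMulti R (μ.colLen j)
      fun i : Fin (μ.colLen j) => b.coord (s (colBoxEquiv μ ⟨j, i⟩))))

theorem colDual_colTabloid [DecidableEq κ] (s u : Tableau μ κ) :
    colDual b s (colTabloid b u) = ∏ j : Fin (μ.rowLen 0),
      Matrix.det (Matrix.of fun i i' : Fin (μ.colLen j) =>
        if u (colBoxEquiv μ ⟨j, i⟩) = s (colBoxEquiv μ ⟨j, i'⟩) then (1 : R) else 0) := by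
  rw [colDual, colTabloid, PiTensorProduct.dualDistrib_apply]
  refine Finset.prod_congr rfl fun j _ => ?_
  rw [exteriorPower.pairingDual_ιMulti_ιMulti]
  congr 2
  funext i i'
  rw [Module.Basis.coord_apply, b.repr_self, Finsupp.single_apply]

theorem colDual_colTabloid_self {s : Tableau μ κ}
    (hs : ∀ c d : Box μ, c.col = d.col → s c = s d → c = d) :
    colDual b s (colTabloid b s) = 1 := by
  classical
  rw [colDual_colTabloid]
  refine Finset.prod_eq_one fun j _ => ?_
  convert Matrix.det_one (n := Fin (μ.colLen j)) (R := R) using 2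
  ext i i'
  rw [Matrix.of_apply, Matrix.one_apply]
  refine if_congr ⟨fun h => ?_, fun h => by rw [h]⟩ rfl rfl
  simpa using hs (colBoxEquiv μ ⟨j, i⟩) (colBoxEquiv μ ⟨j, i'⟩) rfl h

theorem exists_perm_of_colDual_ne_zero {s u : Tableau μ κ}
    (h : colDual b s (colTabloid b u) ≠ 0) (j : Fin (μ.rowLen 0)) :
    ∃ σ : Equiv.Perm (Fin (μ.colLen j)),
      ∀ i, u (colBoxEquiv μ ⟨j, i⟩) = s (colBoxEquiv μ ⟨j, σ i⟩) := by
  classical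
  rw [colDual_colTabloid] at h
  have hj : Matrix.det (Matrix.of fun i i' : Fin (μ.colLen j) =>
      if u (colBoxEquiv μ ⟨j, i⟩) = s (colBoxEquiv μ ⟨j, i'⟩) then (1 : R) else 0) ≠ 0 :=
    fun h0 => h (Finset.prod_eq_zero (Finset.mem_univ j) h0)
  rw [Matrix.det_apply] at hj
  obtain ⟨σ, -, hσ⟩ := Finset.exists_ne_zero_of_sum_ne_zero hj
  have hprod : ∏ i, (Matrix.of fun i i' : Fin (μ.colLen j) =>
      if u (colBoxEquiv μ ⟨j, i⟩) = s (colBoxEquiv μ ⟨j, i'⟩) then (1 : R) else 0) (σ i) i ≠ 0 :=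
    fun h0 => hσ (by rw [h0, smul_zero])
  refine ⟨σ.symm, fun i => ?_⟩
  by_contra hne
  refine hprod (Finset.prod_eq_zero (Finset.mem_univ (σ.symm i)) ?_)
  rw [Matrix.of_apply, σ.apply_symm_apply, if_neg hne]

/-- The rearrangement inequality for a column: sorting it increases the contribution of the column
to the weight, strictly unless it is already sorted. -/
theorem sum_mul_comp_perm_lt_of_strictMono {n : ℕ} {f : Fin n → ℤ} (hf : StrictMono f)
    (σ : Equiv.Perm (Fin n)) :
    σ = 1 ∨ ∑ i : Fin n, ((i : ℕ) : ℤ) * f (σ i) < ∑ i : Fin n, ((i : ℕ) : ℤ) * f i := by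
  have hm : Monovary (fun i : Fin n => ((i : ℕ) : ℤ)) f := by
    intro i i' h
    have := hf.lt_iff_lt.1 h
    simpa using this.le
  rw [hm.sum_mul_comp_perm_lt_sum_mul_iff, or_iff_not_imp_right, not_not]
  intro hσ
  have hmono : Monotone σ := by
    intro i i' hii
    by_contra! hlt
    have h1 := hσ (hf hlt)
    have h2 : i' ≤ i := by simpa using h1
    rw [le_antisymm hii h2] at hlt
    exact lt_irrefl _ hlt
  have h3 : StrictMono σ := hmono.strictMono_of_injective σ.injective
  ext1 i
  have h4 : (h3.orderIsoOfSurjective σ σ.surjective) = OrderIso.refl _ := Subsingleton.elim _ _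
  exact congrArg (fun g : Fin n ≃o Fin n => g i) h4

theorem weight_eq_sum_columns (e : κ → ℤ) (t : Tableau μ κ) :
    weight e t = ∑ j : Fin (μ.rowLen 0), ∑ i : Fin (μ.colLen j),
      ((i : ℕ) : ℤ) * e (t (colBoxEquiv μ ⟨j, i⟩)) := by
  rw [weight, ← Equiv.sum_comp (colBoxEquiv μ), Fintype.sum_sigma]
  rfl

/-- The tableaux contributing to the coefficient of a column-strict tableau `s` have smaller
weight than `s`, except `s` itself. -/
theorem eq_or_weight_lt_of_colDual_ne_zero [LinearOrder κ] {e : κ → ℤ} (he : StrictMono e)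
    {s u : Tableau μ κ} (hs : ∀ c d : Box μ, c.col = d.col → c.row < d.row → s c < s d)
    (h : colDual b s (colTabloid b u) ≠ 0) : u = s ∨ weight e u < weight e s := by
  choose σ hσ using exists_perm_of_colDual_ne_zero b h
  have hf : ∀ j : Fin (μ.rowLen 0), StrictMono
      fun i : Fin (μ.colLen j) => e (s (colBoxEquiv μ ⟨j, i⟩)) :=
    fun j i i' hi => he (hs _ _ rfl hi)
  have key := fun j => sum_mul_comp_perm_lt_of_strictMono (hf j) (σ j)
  by_cases hall : ∀ j, σ j = 1
  · left
    funext c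
    obtain ⟨⟨j, i⟩, rfl⟩ := (colBoxEquiv μ).surjective c
    rw [hσ, hall]
    rfl
  · right
    push Not at hall
    obtain ⟨j, hj⟩ := hall
    rw [weight_eq_sum_columns, weight_eq_sum_columns]
    simp only [hσ]
    refine Finset.sum_lt_sum (fun k _ => ?_) ⟨j, Finset.mem_univ _, (key j).resolve_left hj⟩
    rcases key k with h | h
    · rw [h]
      rfl
    · exact h.le

theorem IsSemistandard.colDual_copolytabloid_self [LinearOrder κ] [Finite κ] {s : Tableau μ κ}
    (hs : IsSemistandard s) : colDual b s (copolytabloid b s) = 1 := by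
  obtain ⟨e, he⟩ := exists_strictMono_int κ
  rw [copolytabloid, map_sum, Finset.sum_eq_single s]
  · refine colDual_colTabloid_self b fun c d hcd h => ?_
    rcases lt_trichotomy c.row d.row with h1 | h1 | h1
    · exact absurd h (hs.2 c d hcd h1).ne
    · exact Box.ext_row_col h1 hcd
    · exact absurd h (hs.2 d c hcd.symm h1).ne'
  · intro u hu hne
    by_contra h0
    refine ((eq_or_weight_lt_of_colDual_ne_zero b he hs.2 h0).resolve_left hne).ne ?_
    exact ((mem_rowOrbit.1 hu).weight_eq e).symm
  · exact fun h => absurd (mem_rowOrbit.2 (.refl s)) h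

theorem IsSemistandard.eq_or_weight_lt [LinearOrder κ] {e : κ → ℤ} (he : StrictMono e)
    {s t : Tableau μ κ} (hs : IsSemistandard s) (ht : IsSemistandard t)
    (h : colDual b s (copolytabloid b t) ≠ 0) : t = s ∨ weight e t < weight e s := by
  rw [copolytabloid, map_sum] at h
  obtain ⟨u, hu, hu0⟩ := Finset.exists_ne_zero_of_sum_ne_zero h
  have htu := mem_rowOrbit.1 hu
  rcases eq_or_weight_lt_of_colDual_ne_zero b he hs.2 hu0 with rfl | hlt
  · exact .inl (htu.eq_of_rowsIncrease ht.1 hs.1)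
  · exact .inr (by rwa [htu.weight_eq e])

/-- The copolytabloids of semistandard tableaux are linearly independent: their matrix against the
functionals `colDual b s` is unitriangular with respect to the weight. -/
theorem linearIndependent_copolytabloid [LinearOrder κ] [Finite κ] :
    LinearIndependent R
      fun s : {t : Tableau μ κ // IsSemistandard t} => copolytabloid b s.1 := by
  obtain ⟨e, he⟩ := exists_strictMono_int κ
  exact linearIndependent_of_unitriangular (fun s => weight e s.1) (fun s => colDual b s.1)
    (fun s => s.2.colDual_copolytabloid_self b)
    fun s t h => (s.2.eq_or_weight_lt b he t.2 h).imp_left Subtype.ext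

end Independence

end Weyl

/-! ### The exact sequence -/

namespace Weyl

section Sequence

variable {R : Type*} [CommRing R] {V : Type*} [AddCommGroup V] [Module R V] {κ : Type*}
  {μ : YoungDiagram} (b : Module.Basis κ R V)

theorem range_symProj [Finite κ] : LinearMap.range (symProj R V μ) = copolytab μ b := by
  rw [LinearMap.range_eq_map, ← span_rsym b, Submodule.map_span, ← Set.range_comp, copolytab]
  congr 2
  funext t
  exact symProj_rsym b t

theorem span_copolytabloid_semistandard [LinearOrder κ] [Finite κ] :
    Submodule.span R (Set.range fun s : {t : Tableau μ κ // IsSemistandard t} =>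
      copolytabloid b s.1) = copolytab μ b := by
  have hG : (dualGarnir μ b).map (symProj R V μ) = ⊥ :=
    LinearMap.le_ker_iff_map.1 (dualGarnir_le_ker_symProj b)
  rw [← range_symProj b, LinearMap.range_eq_map, ← span_rsym_semistandard_sup_dualGarnir b,
    Submodule.map_sup, hG, sup_bot_eq,
    Submodule.map_span, ← Set.range_comp]
  congr 2
  funext s
  exact (symProj_rsym b s.1).symm

theorem ker_symProj [LinearOrder κ] [Finite κ] :
    LinearMap.ker (symProj R V μ) = dualGarnir μ b := by
  classical
  have := Fintype.ofFinite κ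
  refine le_antisymm (fun x hx => ?_) (dualGarnir_le_ker_symProj b)
  have hx' : x ∈ (⊤ : Submodule R (lowerSym R V μ)) := Submodule.mem_top
  rw [← span_rsym_semistandard_sup_dualGarnir b] at hx'
  obtain ⟨y, hy, z, hz, rfl⟩ := Submodule.mem_sup.1 hx'
  rw [LinearMap.mem_ker, map_add, LinearMap.mem_ker.1 (dualGarnir_le_ker_symProj b hz),
    add_zero] at hx
  obtain ⟨a, rfl⟩ := (Submodule.mem_span_range_iff_exists_fun R).1 hy
  simp only [map_sum, map_smul, symProj_rsym] at hx
  have ha := Fintype.linearIndependent_iffₛ.1 (linearIndependent_copolytabloid b) a 0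
    (by simpa using hx)
  simpa [ha] using hz

/-- The copolytabloids of the semistandard tableaux, as a basis of `copolytab μ b`. -/
noncomputable def copolytabBasis [LinearOrder κ] [Finite κ] :
    Module.Basis {t : Tableau μ κ // IsSemistandard t} R (copolytab μ b) :=
  (Module.Basis.span (linearIndependent_copolytabloid b)).map
    (LinearEquiv.ofEq _ _ (span_copolytabloid_semistandard b))

theorem coe_copolytabBasis [LinearOrder κ] [Finite κ]
    (s : {t : Tableau μ κ // IsSemistandard t}) :
    (copolytabBasis b s : ColWedge R V μ) = copolytabloid b s.1 := by
  rw [copolytabBasis, Module.Basis.map_apply, LinearEquiv.coe_ofEq_apply,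
    Module.Basis.span_apply]

variable {G : Type*} [Group G] (ρ : Representation R G V)

theorem colProj_tensorRep (g : G) (x : TensorPow R V μ) :
    colProj R V μ (tensorRep μ ρ g x) = wedgeRep μ ρ g (colProj R V μ x) := by
  have h : colProj R V μ ∘ₗ tensorRep μ ρ g = wedgeRep μ ρ g ∘ₗ colProj R V μ := by
    refine PiTensorProduct.ext (MultilinearMap.ext fun v => ?_)
    have h1 : tensorRep μ ρ g (PiTensorProduct.tprod R v) =
        PiTensorProduct.tprod R fun c => ρ g (v c) := PiTensorProduct.map_tprod _ _
    have h2 : ∀ w : (j : Fin (μ.rowLen 0)) → ⋀[R]^(μ.colLen j) V,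
        wedgeRep μ ρ g (PiTensorProduct.tprod R w) =
        PiTensorProduct.tprod R fun j : Fin (μ.rowLen 0) =>
          exteriorPower.map (μ.colLen j) (ρ g) (w j) :=
      fun w => PiTensorProduct.map_tprod _ _
    simp only [LinearMap.compMultilinearMap_apply, LinearMap.comp_apply]
    rw [h1, colProj_tprod, colProj_tprod, h2]
    congr 1
    funext j
    rw [exteriorPower.map_apply_ιMulti]
    rfl
  exact LinearMap.congr_fun h x

theorem symProj_symRep (g : G) (x : lowerSym R V μ) :
    symProj R V μ (symRep μ ρ g x) = wedgeRep μ ρ g (symProj R V μ x) :=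
  colProj_tensorRep ρ g (x : TensorPow R V μ)

/-- The dual Garnir relations form a subrepresentation, being the kernel of an equivariant map. -/
def dualGarnirSub [LinearOrder κ] [Finite κ] : Subrepresentation (symRep μ ρ) where
  toSubmodule := dualGarnir μ b
  apply_mem_toSubmodule g x hx := by
    rw [← ker_symProj b, LinearMap.mem_ker] at hx ⊢
    rw [symProj_symRep, hx, map_zero]

/-- The span of the copolytabloids is a subrepresentation, being the range of an equivariant
map. -/
def copolytabSub [Finite κ] : Subrepresentation (wedgeRep μ ρ) where
  toSubmodule := copolytab μ b
  apply_mem_toSubmodule g x hx := by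
    rw [← range_symProj b] at hx ⊢
    obtain ⟨y, rfl⟩ := hx
    exact ⟨symRep μ ρ g y, symProj_symRep ρ g y⟩

/-- The projection from the row-symmetric tensors onto the span of the copolytabloids. -/
noncomputable def symToCopolytab [Finite κ] :
    Representation.IntertwiningMap (symRep μ ρ) (copolytabSub (μ := μ) b ρ).toRepresentation :=
  LinearMap.intertwiningMap_of_isIntertwiningMap _ _
    ((symProj R V μ).codRestrict (copolytab μ b) fun x =>
      range_symProj b ▸ LinearMap.mem_range_self _ x)
    fun g x => Subtype.ext (symProj_symRep ρ g x)

theorem coe_symToCopolytab [Finite κ] (x : lowerSym R V μ) :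
    (symToCopolytab b ρ x : ColWedge R V μ) = symProj R V μ x := rfl

end Sequence

end Weyl

theorem theorem1p2 {R : Type*} [CommRing R] {G : Type*} [Group G]
    {V : Type*} [AddCommGroup V] [Module R V] (ρ : Representation R G V)
    {κ : Type*} [LinearOrder κ] [Finite κ] (b : Module.Basis κ R V) (μ : YoungDiagram) :
    (∃ (K : Subrepresentation (Weyl.symRep μ ρ)) (C : Subrepresentation (Weyl.wedgeRep μ ρ))
      (L : Representation.IntertwiningMap (Weyl.symRep μ ρ) C.toRepresentation),
      K.toSubmodule = Weyl.dualGarnir μ b ∧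
      C.toSubmodule = Weyl.copolytab μ b ∧
      (∀ x : Weyl.lowerSym R V μ, (L x : Weyl.ColWedge R V μ) = Weyl.colProj R V μ x) ∧
      (∀ t : Weyl.Tableau μ κ,
        (L (Weyl.rsym b t) : Weyl.ColWedge R V μ) = Weyl.copolytabloid b t) ∧
      Function.Injective K.toSubmodule.subtype ∧
      Function.Exact K.toSubmodule.subtype L ∧
      Function.Surjective L) ∧
    (∃ B : Module.Basis {t : Weyl.Tableau μ κ // Weyl.IsSemistandard t} R (Weyl.copolytab μ b),
      ∀ s, (B s : Weyl.ColWedge R V μ) = Weyl.copolytabloid b s.1) := by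
  refine ⟨⟨Weyl.dualGarnirSub b ρ, Weyl.copolytabSub b ρ, Weyl.symToCopolytab b ρ, rfl, rfl,
    fun _ => rfl, Weyl.symProj_rsym b, Submodule.subtype_injective _, fun x => ?_, ?_⟩,
    Weyl.copolytabBasis b, Weyl.coe_copolytabBasis b⟩
  · rw [← Subtype.coe_inj, Weyl.coe_symToCopolytab, ZeroMemClass.coe_zero, ← LinearMap.mem_ker,
      Weyl.ker_symProj b]
    exact Subtype.range_coe.symm ▸ Iff.rfl
  · rintro ⟨y, hy⟩
    obtain ⟨x, rfl⟩ : y ∈ LinearMap.range (Weyl.symProj R V μ) := Weyl.range_symProj b ▸ hy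
    exact ⟨x, rfl⟩
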